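/- For $A\subseteq\mathbb N$ and $n\ge 1$ let $\rho_n(A)=|A\cap\{0,\dots,n-1\}|/n$, and let $\underline\rho(A)=\liminf_{n\to\infty}\rho_n(A)$ be the lower density of $A$. For $r\in[0,1]$, the set $A$ is \emph{coarsely computable at density $r$} if there is a computable set $B\subseteq\mathbb N$ such that $\underline\rho(\{n : n\in A\Leftrightarrow n\in B\})\ge r$. The \emph{coarse computability bound} of $A$ is $\gamma(A)=\sup\{r\in[0,1] : A\text{ is coarsely computable at density }r\}$. A real $r$ is \emph{left-$\Sigma^0_3$} if $\{q\in\mathbb Q : q<r\}$ is a $\Sigma^0_3$ set (with respect to a standard coding of the rationals by natural numbers). Theorem. Let $0\le r\le 1$. Then the following are equivalent: (i) $r=\gamma(A)$ for some c.e. set $A\subseteq\mathbb N$; (ii) $r$ is left-$\Sigma^0_3$. -/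

import Mathlib

namespace CoarseComputability

/-- The density of `A` below `n`, i.e. `|A ∩ {0, …, n - 1}| / n`. -/
noncomputable def densityBelow (A : Set ℕ) (n : ℕ) : ℝ :=
  ((A ∩ Set.Iio n).ncard : ℝ) / (n : ℝ)

/-- The lower (asymptotic) density of `A`. -/
noncomputable def lowerDensity (A : Set ℕ) : ℝ :=
  Filter.liminf (fun n : ℕ => densityBelow A n) Filter.atTop

/-- The set of numbers on which (the characteristic functions of) `A` and `B` agree. -/
def agreement (A B : Set ℕ) : Set ℕ :=
  {n | n ∈ A ↔ n ∈ B}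

/-- `B` is an `r`-description of `A`. -/
def IsDescription (r : ℝ) (A B : Set ℕ) : Prop :=
  r ≤ lowerDensity (agreement A B)

/-- `A` is coarsely computable at density `r`: it has a computable `r`-description. -/
def CoarselyComputableAt (A : Set ℕ) (r : ℝ) : Prop :=
  ∃ B : Set ℕ, ComputablePred (fun n => n ∈ B) ∧ IsDescription r A B

/-- The coarse computability bound `γ(A)`. The set below contains `0` and is bounded by `1`. -/
noncomputable def gamma (A : Set ℕ) : ℝ :=
  sSup {r : ℝ | r ∈ Set.Icc (0 : ℝ) 1 ∧ CoarselyComputableAt A r}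

/-- `A` is computably enumerable. -/
def IsCE (A : Set ℕ) : Prop :=
  REPred (fun n => n ∈ A)

/-- `p` is a `Σ⁰₃` predicate: `p a ↔ ∃ x, ∀ y, ∃ z, R a x y z` with `R` computable. -/
def IsSigmaThree {α : Type*} [Primcodable α] (p : α → Prop) : Prop :=
  ∃ R : α × ℕ × ℕ × ℕ → Prop, ComputablePred R ∧
    ∀ a, p a ↔ ∃ x, ∀ y, ∃ z, R (a, x, y, z)

/-- The rational number `(a - b) / (c + 1)` coded by the triple `(a, b, c)`;
every rational number has a code. -/
def ratOfCode (t : ℕ × ℕ × ℕ) : ℚ :=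
  ((t.1 : ℚ) - (t.2.1 : ℚ)) / ((t.2.2 : ℚ) + 1)

/-- A set of rational numbers is `Σ⁰₃` if the set of all codes of its elements is `Σ⁰₃`. -/
def IsSigmaThreeRat (S : Set ℚ) : Prop :=
  IsSigmaThree (fun t : ℕ × ℕ × ℕ => ratOfCode t ∈ S)

/-- A real `r` is left-`Σ⁰₃` if `{q ∈ ℚ : q < r}` is `Σ⁰₃`. -/
def IsLeftSigmaThree (r : ℝ) : Prop :=
  IsSigmaThreeRat {q : ℚ | (q : ℝ) < r}

end CoarseComputability

/-! If A is c.e., then q < γ(A) iff some total index e, with zero set B, and some k, N make the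
agreement of A and B below n have density at least q + 1/(k+1) for every n > N. For fixed n, the
approximations to A and B below n are eventually correct, so the inequality holds iff it is observed
at arbitrarily late stages. This gives the form ∃(e,k,N) ∀(n,u) ∃ s, proved in
`isLeftSigmaThree_gamma`.

Conversely, `IsLeftSigmaThree.exists_sequence` turns r into a computable list of rationals q_k, each
with a Π⁰₂ condition that forces q_k < r, such that every rational below r occurs with a true
condition. The interval [n!, (n+1)!) is assigned a target e, and each e receives infinitely many
intervals. There `diagonalSet` copies the zeros of the e-th function, and adds the initial parts of
density q_k for those k ≤ e whose condition is confirmed up to n.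

Upper bound (`gamma_diagonalSet_le`): let e be an index whose zeros are the complement of a
computable B. On late intervals with target e, false conditions no longer contribute and true ones
stay inside `initialParts r`. Agreement with B is thus confined to that set, and such an interval
fills almost all of [0, (n+1)!).

Lower bound (`ratOfCode_le_gamma_diagonalSet`): a true condition k puts the initial parts of density
q_k into A wherever the target is at least k. On the finitely many smaller targets A is computable,
though not uniformly, and can be copied exactly. -/

open Filter Topology

namespace CoarseComputability

/-! ### Closure properties of computable predicates -/

section Computability

variable {α β : Type*} [Primcodable α] [Primcodable β] {p q : α → Prop}

theorem computablePred_comp {p : β → Prop} {f : α → β} (hp : ComputablePred p)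
    (hf : Computable f) : ComputablePred fun a => p (f a) := by
  obtain ⟨g, hg, rfl⟩ := ComputablePred.computable_iff.1 hp
  exact ComputablePred.computable_iff.2 ⟨_, hg.comp hf, rfl⟩

theorem computablePred_and (hp : ComputablePred p) (hq : ComputablePred q) :
    ComputablePred fun a => p a ∧ q a := by
  obtain ⟨f, hf, rfl⟩ := ComputablePred.computable_iff.1 hp
  obtain ⟨g, hg, rfl⟩ := ComputablePred.computable_iff.1 hq
  exact ComputablePred.computable_iff.2
    ⟨fun a => f a && g a, Primrec.and.to_comp.comp hf hg, by simp⟩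

theorem computablePred_or (hp : ComputablePred p) (hq : ComputablePred q) :
    ComputablePred fun a => p a ∨ q a := by
  obtain ⟨f, hf, rfl⟩ := ComputablePred.computable_iff.1 hp
  obtain ⟨g, hg, rfl⟩ := ComputablePred.computable_iff.1 hq
  exact ComputablePred.computable_iff.2
    ⟨fun a => f a || g a, Primrec.or.to_comp.comp hf hg, by simp⟩

theorem computablePred_const (P : Prop) : ComputablePred fun _ : α => P := by
  classical
  exact ComputablePred.computable_iff.2 ⟨fun _ => decide P, Computable.const _, by simp⟩

theorem computablePred_lt {f g : α → ℕ} (hf : Computable f) (hg : Computable g) :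
    ComputablePred fun a => f a < g a :=
  computablePred_comp (p := fun x : ℕ × ℕ => x.1 < x.2)
    (PrimrecPred.computablePred Primrec.nat_lt) (hf.pair hg)

theorem computablePred_le {f g : α → ℕ} (hf : Computable f) (hg : Computable g) :
    ComputablePred fun a => f a ≤ g a :=
  computablePred_comp (p := fun x : ℕ × ℕ => x.1 ≤ x.2)
    (PrimrecPred.computablePred Primrec.nat_le) (hf.pair hg)

theorem computablePred_eq {f g : α → β} (hf : Computable f) (hg : Computable g) :
    ComputablePred fun a => f a = g a :=
  computablePred_comp (p := fun x : β × β => x.1 = x.2)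
    (PrimrecPred.computablePred Primrec.eq) (hf.pair hg)

theorem computable_add {f g : α → ℕ} (hf : Computable f) (hg : Computable g) :
    Computable fun a => f a + g a :=
  Primrec.nat_add.to_comp.comp hf hg

theorem computable_sub {f g : α → ℕ} (hf : Computable f) (hg : Computable g) :
    Computable fun a => f a - g a :=
  Primrec.nat_sub.to_comp.comp hf hg

theorem computable_mul {f g : α → ℕ} (hf : Computable f) (hg : Computable g) :
    Computable fun a => f a * g a :=
  Primrec.nat_mul.to_comp.comp hf hg

theorem computable_count {p : α → ℕ → Prop} [∀ a, DecidablePred (p a)] {f : α → ℕ}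
    (hp : ComputablePred fun x : α × ℕ => p x.1 x.2) (hf : Computable f) :
    Computable fun a => Nat.count (p a) (f a) := by
  have hd : Computable fun x : α × ℕ => decide (p x.1 x.2) := hp.decide
  have hstep : Computable₂ fun (a : α) (x : ℕ × ℕ) => x.2 + cond (decide (p a x.1)) 1 0 :=
    computable_add (Computable.snd.comp Computable.snd)
      (Computable.cond (hd.comp (Computable.fst.pair (Computable.fst.comp Computable.snd)))
        (Computable.const 1) (Computable.const 0))
  refine (Computable.nat_rec hf (Computable.const 0) hstep).of_eq fun a => ?_
  induction f a with
  | zero => simp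
  | succ n ih =>
    simp only [ih, Nat.count_succ]
    by_cases h : p a n <;> simp [h]

theorem computablePred_forall_lt {p : α → ℕ → Prop} {f : α → ℕ}
    (hp : ComputablePred fun x : α × ℕ => p x.1 x.2) (hf : Computable f) :
    ComputablePred fun a => ∀ i < f a, p a i := by
  classical
  exact (computablePred_eq (computable_count hp hf) hf).of_eq fun a => Nat.count_iff_forall

theorem computablePred_exists_lt {p : α → ℕ → Prop} {f : α → ℕ}
    (hp : ComputablePred fun x : α × ℕ => p x.1 x.2) (hf : Computable f) :
    ComputablePred fun a => ∃ i < f a, p a i :=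
  (ComputablePred.not (computablePred_forall_lt (p := fun a i => ¬ p a i)
    (ComputablePred.not hp) hf)).of_eq fun a => by push Not; rfl

/-- A projection of a computable predicate is computably enumerable. -/
theorem rePred_exists {p : α × ℕ → Prop} (hp : ComputablePred p) :
    REPred fun a => ∃ s, p (a, s) := by
  obtain ⟨f, hf, rfl⟩ := ComputablePred.computable_iff.1 hp
  refine (Partrec.dom_re (Partrec.rfind (p := fun a n => Part.some (f (a, n)))
    hf.partrec.to₂)).of_eq fun a => ?_
  refine Nat.rfind_dom.trans ?_
  exact exists_congr fun s => ⟨fun h => (Part.mem_some_iff.1 h.1).symm,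
    fun h => ⟨Part.mem_some_iff.2 h.symm, fun _ => trivial⟩⟩

theorem computablePred_of_bounded {p : ℕ → Prop} (N : ℕ) (h : ∀ x, p x → x < N) :
    ComputablePred p := by
  induction N generalizing p with
  | zero => exact (computablePred_const False).of_eq fun x =>
      ⟨False.elim, fun hx => absurd (h x hx) (Nat.not_lt_zero x)⟩
  | succ N ih =>
    have h1 : ComputablePred fun x => p x ∧ x ≠ N :=
      ih fun x hx => lt_of_le_of_ne (Nat.lt_succ_iff.1 (h x hx.1)) hx.2
    have h2 : ComputablePred fun x => x = N ∧ p N :=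
      computablePred_and (computablePred_eq Computable.id (Computable.const N))
        (computablePred_const _)
    refine (computablePred_or h1 h2).of_eq fun x => ?_
    by_cases hx : x = N <;> simp [hx]

/-- Since `N` is a fixed number, the predicates `p k` need not be computable uniformly in `k`; the
decision procedures below depend on unknown facts about each index. -/
theorem computablePred_exists_lt_const {p : ℕ → α → Prop} (N : ℕ)
    (h : ∀ k < N, ComputablePred (p k)) : ComputablePred fun a => ∃ k < N, p k a := by
  induction N with
  | zero => exact (computablePred_const False).of_eq fun x => by simp
  | succ N ih =>
    refine (computablePred_or (ih fun k hk => h k (hk.trans N.lt_succ_self))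
      (h N N.lt_succ_self)).of_eq fun a => ?_
    simp only [Nat.lt_succ_iff_lt_or_eq, or_and_right, exists_or, exists_eq_left]

/-- The step-bounded universal function, with codes given by natural numbers. -/
def evalSteps (s e x : ℕ) : Option ℕ :=
  Nat.Partrec.Code.evaln s (Denumerable.ofNat Nat.Partrec.Code e) x

theorem computable_evalSteps {f g h : α → ℕ} (hf : Computable f) (hg : Computable g)
    (hh : Computable h) : Computable fun a => evalSteps (f a) (g a) (h a) :=
  Nat.Partrec.Code.primrec_evaln.to_comp.comp
    ((hf.pair ((Computable.ofNat Nat.Partrec.Code).comp hg)).pair hh)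

theorem evalSteps_mono {s t e x v : ℕ} (hst : s ≤ t) (h : evalSteps s e x = some v) :
    evalSteps t e x = some v :=
  Nat.Partrec.Code.evaln_mono hst h

theorem evalSteps_unique {s t e x v w : ℕ} (hv : evalSteps s e x = some v)
    (hw : evalSteps t e x = some w) : v = w :=
  Part.mem_unique (Nat.Partrec.Code.evaln_sound hv) (Nat.Partrec.Code.evaln_sound hw)

/-- Every computable function has an index. -/
theorem exists_index {f : ℕ → ℕ} (hf : Computable f) :
    ∃ e, ∀ x, ∃ s, evalSteps s e x = some (f x) := by
  obtain ⟨c, hc⟩ := Nat.Partrec.Code.exists_code.1 (Partrec.nat_iff.1 hf.partrec)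
  refine ⟨Encodable.encode c, fun x => ?_⟩
  have : f x ∈ c.eval x := by rw [hc]; exact Part.mem_some _
  obtain ⟨s, hs⟩ := Nat.Partrec.Code.evaln_complete.1 this
  exact ⟨s, by simpa [evalSteps] using hs⟩

/-- If the function with index `e` is total, then it is computable. -/
theorem computable_of_index {e : ℕ} {f : ℕ → ℕ} (h : ∀ x, ∃ s, evalSteps s e x = some (f x)) :
    Computable f := by
  have : Partrec (Denumerable.ofNat Nat.Partrec.Code e).eval :=
    Nat.Partrec.Code.eval_part.comp (Computable.const _) Computable.id
  refine this.of_eq_tot fun x => ?_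
  obtain ⟨s, hs⟩ := h x
  exact Nat.Partrec.Code.evaln_sound hs

/-- Every computable set is the set of zeros of a total function with an index. -/
theorem exists_index_of_computablePred {p : ℕ → Prop} (hp : ComputablePred p) :
    ∃ e, ∃ f : ℕ → ℕ, (∀ x, ∃ s, evalSteps s e x = some (f x)) ∧ ∀ x, f x = 0 ↔ p x := by
  classical
  have hf : Computable fun x => cond (decide (p x)) 0 1 :=
    Computable.cond hp.decide (Computable.const 0) (Computable.const 1)
  obtain ⟨e, he⟩ := exists_index hf
  exact ⟨e, _, he, fun x => by by_cases h : p x <;> simp [h]⟩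

/-- Every computably enumerable set is the domain of a function with an index. -/
theorem exists_index_of_rePred {p : ℕ → Prop} (hp : REPred p) :
    ∃ e, ∀ x, p x ↔ ∃ s, (evalSteps s e x).isSome := by
  have h1 : Partrec fun x => (Part.assert (p x) fun _ => Part.some ()).map fun _ => 0 :=
    Partrec.map hp (Computable.const 0).to₂
  obtain ⟨c, hc⟩ := Nat.Partrec.Code.exists_code.1 (Partrec.nat_iff.1 h1)
  refine ⟨Encodable.encode c, fun x => ?_⟩
  have key : p x ↔ (c.eval x).Dom := by rw [hc]; simp [Part.assert]
  rw [key, Part.dom_iff_mem]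
  simp only [Nat.Partrec.Code.evaln_complete, Option.isSome_iff_exists, evalSteps,
    Denumerable.ofNat_encode]
  exact exists_comm

end Computability

/-! ### Densities -/

open Classical in
theorem densityBelow_eq_count (A : Set ℕ) (n : ℕ) :
    densityBelow A n = (Nat.count (· ∈ A) n : ℝ) / n := by
  rw [densityBelow, Nat.count_eq_card_filter_range, ← Set.ncard_coe_finset]
  congr 3
  ext x
  simp [and_comm]

theorem densityBelow_nonneg (A : Set ℕ) (n : ℕ) : 0 ≤ densityBelow A n := by
  unfold densityBelow; positivity

theorem densityBelow_le_one (A : Set ℕ) (n : ℕ) : densityBelow A n ≤ 1 := by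
  classical
  rw [densityBelow_eq_count]
  exact div_le_one_of_le₀ (by exact_mod_cast Nat.count_le _) (Nat.cast_nonneg _)

theorem densityBelow_mono {A B : Set ℕ} (h : A ⊆ B) (n : ℕ) :
    densityBelow A n ≤ densityBelow B n := by
  unfold densityBelow
  gcongr
  exact (Set.finite_Iio n).inter_of_right B

theorem le_lowerDensity {A : Set ℕ} {c : ℝ} (h : ∀ᶠ n in atTop, c ≤ densityBelow A n) :
    c ≤ lowerDensity A :=
  le_liminf_of_le (IsBoundedUnder.isCoboundedUnder_ge
    (isBoundedUnder_of ⟨1, densityBelow_le_one A⟩)) h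

theorem lowerDensity_le {A : Set ℕ} {c : ℝ} (h : ∃ᶠ n in atTop, densityBelow A n ≤ c) :
    lowerDensity A ≤ c :=
  liminf_le_of_frequently_le h (isBoundedUnder_of ⟨0, densityBelow_nonneg A⟩)

theorem eventually_lt_densityBelow {A : Set ℕ} {c : ℝ} (h : c < lowerDensity A) :
    ∀ᶠ n in atTop, c < densityBelow A n :=
  eventually_lt_of_lt_liminf h (isBoundedUnder_of ⟨0, densityBelow_nonneg A⟩)

theorem lowerDensity_mono {A B : Set ℕ} (h : A ⊆ B) : lowerDensity A ≤ lowerDensity B :=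
  liminf_le_liminf (Eventually.of_forall (densityBelow_mono h))
    (isBoundedUnder_of ⟨0, densityBelow_nonneg A⟩)
    (IsBoundedUnder.isCoboundedUnder_ge (isBoundedUnder_of ⟨1, densityBelow_le_one B⟩))

theorem lowerDensity_nonneg (A : Set ℕ) : 0 ≤ lowerDensity A :=
  le_lowerDensity (Eventually.of_forall (densityBelow_nonneg A))

theorem lowerDensity_le_one (A : Set ℕ) : lowerDensity A ≤ 1 :=
  lowerDensity_le (Frequently.of_forall (densityBelow_le_one A))

theorem le_gamma {A : Set ℕ} {B : Set ℕ} (hB : ComputablePred (· ∈ B)) :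
    lowerDensity (agreement A B) ≤ gamma A :=
  le_csSup ⟨1, fun _ hx => hx.1.2⟩
    ⟨⟨lowerDensity_nonneg _, lowerDensity_le_one _⟩, B, hB, le_rfl⟩

theorem lt_gamma_iff {A : Set ℕ} {c : ℝ} :
    c < gamma A ↔ ∃ B : Set ℕ, ComputablePred (· ∈ B) ∧ c < lowerDensity (agreement A B) := by
  refine ⟨fun h => ?_, fun ⟨B, hB, h⟩ => h.trans_le (le_gamma hB)⟩
  have hne : {r : ℝ | r ∈ Set.Icc (0 : ℝ) 1 ∧ CoarselyComputableAt A r}.Nonempty :=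
    ⟨0, ⟨le_rfl, zero_le_one⟩, ∅, computablePred_const False, lowerDensity_nonneg _⟩
  obtain ⟨r, ⟨-, B, hB, hr⟩, hcr⟩ := exists_lt_of_lt_csSup hne h
  exact ⟨B, hB, hcr.trans_le hr⟩

/-! ### A family of sets of prescribed density -/

/-- The set of all numbers that lie in the initial part of relative length `q` of one of the blocks
`[s ^ 2, (s + 1) ^ 2)`. -/
def initialParts (q : ℝ) : Set ℕ :=
  {x | ((x - x.sqrt ^ 2 : ℕ) : ℝ) < q * (2 * x.sqrt + 1)}

theorem initialParts_mono {p q : ℝ} (h : p ≤ q) : initialParts p ⊆ initialParts q :=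
  fun _ hx => lt_of_lt_of_le hx (mul_le_mul_of_nonneg_right h (by positivity))

theorem mem_initialParts_block {q : ℝ} {s j : ℕ} (hj : j < 2 * s + 1) :
    s ^ 2 + j ∈ initialParts q ↔ (j : ℝ) < q * (2 * s + 1) := by
  have h : (s ^ 2 + j).sqrt = s := by
    rw [pow_two]; exact Nat.sqrt_add_eq s (by omega)
  simp [initialParts, h]

open Classical in
theorem count_lt_real (y : ℝ) (n : ℕ) : Nat.count (fun j : ℕ => (j : ℝ) < y) n = min ⌈y⌉₊ n := by
  induction n with
  | zero => simp
  | succ n ih =>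
    rw [Nat.count_succ, ih]
    simp only [← Nat.lt_ceil]
    split_ifs <;> omega

open Classical in
theorem count_initialParts_sq_succ (q : ℝ) (s : ℕ) :
    Nat.count (· ∈ initialParts q) ((s + 1) ^ 2) =
      Nat.count (· ∈ initialParts q) (s ^ 2) + min ⌈q * (2 * s + 1)⌉₊ (2 * s + 1) := by
  rw [show (s + 1) ^ 2 = s ^ 2 + (2 * s + 1) by ring, Nat.count_add, ← count_lt_real]
  congr 1
  rw [Nat.count_eq_card_filter_range, Nat.count_eq_card_filter_range]
  congr 1
  exact Finset.filter_congr fun j hj => mem_initialParts_block (Finset.mem_range.1 hj)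

open Classical in
-- Each block rounds its share up, so nothing is lost; `q ≤ 1` keeps that share within the block
-- length.
theorem le_count_initialParts_sq {q : ℝ} (h1 : q ≤ 1) (s : ℕ) :
    q * s ^ 2 ≤ Nat.count (· ∈ initialParts q) (s ^ 2) := by
  induction s with
  | zero => simp
  | succ s ih =>
    rw [count_initialParts_sq_succ]
    have : q * (2 * s + 1) ≤ (min ⌈q * (2 * s + 1)⌉₊ (2 * s + 1) : ℕ) := by
      rw [Nat.cast_min]
      refine le_min (Nat.le_ceil _) ?_
      push_cast
      nlinarith
    push_cast at this ⊢
    nlinarith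

open Classical in
-- Rounding up costs at most one element per block.
theorem count_initialParts_sq_le {q : ℝ} (h0 : 0 ≤ q) (s : ℕ) :
    Nat.count (· ∈ initialParts q) (s ^ 2) ≤ q * s ^ 2 + s := by
  induction s with
  | zero => simp
  | succ s ih =>
    rw [count_initialParts_sq_succ]
    have : (min ⌈q * (2 * s + 1)⌉₊ (2 * s + 1) : ℕ) ≤ q * (2 * s + 1) + 1 := by
      rw [Nat.cast_min]
      exact (min_le_left _ _).trans (Nat.ceil_lt_add_one (by positivity)).le
    push_cast at this ⊢
    nlinarith

theorem abs_densityBelow_initialParts_sub_le {q : ℝ} (h0 : 0 ≤ q) (h1 : q ≤ 1) {n : ℕ}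
    (hn : 0 < n) : |densityBelow (initialParts q) n - q| ≤ 5 / √(n : ℝ) := by
  classical
  set s := n.sqrt with hs
  have hs1 : s ^ 2 ≤ n := Nat.sqrt_le' n
  have hs2 : n ≤ (s + 1) ^ 2 := (Nat.lt_succ_sqrt' n).le
  have hs0 : (1 : ℝ) ≤ s := by exact_mod_cast Nat.sqrt_pos.2 hn
  have c1 : (Nat.count (· ∈ initialParts q) (s ^ 2) : ℝ) ≤ Nat.count (· ∈ initialParts q) n := by
    exact_mod_cast Nat.count_monotone _ hs1
  have c2 : (Nat.count (· ∈ initialParts q) n : ℝ) ≤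
      Nat.count (· ∈ initialParts q) ((s + 1) ^ 2) := by
    exact_mod_cast Nat.count_monotone _ hs2
  have b1 := le_count_initialParts_sq h1 s
  have b2 := count_initialParts_sq_le h0 (s + 1)
  have hs1' : (s : ℝ) ^ 2 ≤ n := by exact_mod_cast hs1
  have hs2' : (n : ℝ) ≤ (s + 1) ^ 2 := by exact_mod_cast hs2
  push_cast at b2
  have hn' : (0 : ℝ) < n := by exact_mod_cast hn
  have hsn : (s : ℝ) ≤ √(n : ℝ) := Real.le_sqrt_of_sq_le hs1'
  -- One incomplete block contributes at most 2s + 1 and rounding at most s + 1; the sum 3s + 2 is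
  -- at most 5s because s ≥ 1.
  have key : |(Nat.count (· ∈ initialParts q) n : ℝ) - q * n| ≤ 5 * √(n : ℝ) := by
    rw [abs_le]
    constructor <;> nlinarith
  have e1 : (Nat.count (· ∈ initialParts q) n : ℝ) / n - q =
      ((Nat.count (· ∈ initialParts q) n : ℝ) - q * n) / n := by field_simp
  rw [densityBelow_eq_count, e1, abs_div, abs_of_pos hn', div_le_div_iff₀ hn' (Real.sqrt_pos.2 hn')]
  calc _ ≤ 5 * √(n : ℝ) * √(n : ℝ) := by gcongr
    _ = 5 * n := by rw [mul_assoc, Real.mul_self_sqrt hn'.le]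

theorem tendsto_densityBelow_initialParts {q : ℝ} (h0 : 0 ≤ q) (h1 : q ≤ 1) :
    Tendsto (densityBelow (initialParts q)) atTop (𝓝 q) := by
  rw [tendsto_iff_norm_sub_tendsto_zero]
  refine squeeze_zero' (Eventually.of_forall fun _ => norm_nonneg _)
    ((eventually_gt_atTop 0).mono fun n hn => abs_densityBelow_initialParts_sub_le h0 h1 hn) ?_
  exact (Real.tendsto_sqrt_atTop.comp tendsto_natCast_atTop_atTop).const_div_atTop 5

theorem lowerDensity_initialParts {q : ℝ} (h0 : 0 ≤ q) (h1 : q ≤ 1) :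
    lowerDensity (initialParts q) = q :=
  (tendsto_densityBelow_initialParts h0 h1).liminf_eq

/-- Clearing the denominator and moving the negative term across leaves an inequality of natural
numbers, hence a decidable one. -/
theorem mem_initialParts_ratOfCode (t : ℕ × ℕ × ℕ) (x : ℕ) :
    x ∈ initialParts (ratOfCode t) ↔
      (x - x.sqrt * x.sqrt) * (t.2.2 + 1) + t.2.1 * (2 * x.sqrt + 1) < t.1 * (2 * x.sqrt + 1) := by
  have hc : (0 : ℝ) < (t.2.2 : ℝ) + 1 := by positivity
  rw [← Nat.cast_lt (α := ℝ), initialParts, Set.mem_ofPred_eq, ratOfCode, pow_two]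
  push_cast
  rw [div_mul_eq_mul_div, lt_div_iff₀ hc, sub_mul, lt_sub_iff_add_lt]

theorem computablePred_mem_initialParts :
    ComputablePred fun y : (ℕ × ℕ × ℕ) × ℕ => y.2 ∈ initialParts (ratOfCode y.1) := by
  have hs : Computable fun y : (ℕ × ℕ × ℕ) × ℕ => y.2.sqrt :=
    Primrec.nat_sqrt.to_comp.comp Computable.snd
  have h2 : Computable fun y : (ℕ × ℕ × ℕ) × ℕ => 2 * y.2.sqrt + 1 :=
    computable_add (computable_mul (Computable.const 2) hs) (Computable.const 1)
  have hc1 : Computable fun y : (ℕ × ℕ × ℕ) × ℕ => y.1.1 := Computable.fst.comp Computable.fst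
  have hc : Computable fun y : (ℕ × ℕ × ℕ) × ℕ => y.1.2 := Computable.snd.comp Computable.fst
  refine (computablePred_lt
    (computable_add
      (computable_mul (computable_sub Computable.snd (computable_mul hs hs))
        (computable_add (Computable.snd.comp hc) (Computable.const 1)))
      (computable_mul (Computable.fst.comp hc) h2))
    (computable_mul hc1 h2)).of_eq fun y => ?_
  exact (mem_initialParts_ratOfCode y.1 y.2).symm

theorem computablePred_mem_initialParts_const (t : ℕ × ℕ × ℕ) :
    ComputablePred (· ∈ initialParts (ratOfCode t)) :=
  computablePred_comp (f := fun x => (t, x)) computablePred_mem_initialParts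
    ((Computable.const t).pair Computable.id)

/-! ### The coarse computability bound of a c.e. set is left-`Σ⁰₃` -/

/-- Both approximations only gain information, and finitely many arguments have a common stage after
which nothing changes. -/
theorem exists_forall_evalSteps_eq {e₀ e : ℕ} {A : Set ℕ} {f : ℕ → ℕ}
    (hA : ∀ x, x ∈ A ↔ ∃ s, (evalSteps s e₀ x).isSome)
    (hf : ∀ x, ∃ s, evalSteps s e x = some (f x)) (n : ℕ) :
    ∃ s₀, ∀ s ≥ s₀, ∀ i < n, evalSteps s e i = some (f i) ∧
      ((evalSteps s e₀ i).isSome ↔ i ∈ A) := by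
  have mono : ∀ {s t i : ℕ}, s ≤ t → (evalSteps s e₀ i).isSome → (evalSteps t e₀ i).isSome := by
    intro s t i hst h
    obtain ⟨v, hv⟩ := Option.isSome_iff_exists.1 h
    exact Option.isSome_iff_exists.2 ⟨v, evalSteps_mono hst hv⟩
  induction n with
  | zero => exact ⟨0, by simp⟩
  | succ n ih =>
    obtain ⟨s₀, h₀⟩ := ih
    obtain ⟨s₁, h₁⟩ := hf n
    obtain ⟨s₂, h₂⟩ : ∃ s₂, n ∈ A → (evalSteps s₂ e₀ n).isSome := by
      by_cases hn : n ∈ A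
      · obtain ⟨s, hs⟩ := (hA n).1 hn
        exact ⟨s, fun _ => hs⟩
      · exact ⟨0, fun h => absurd h hn⟩
    refine ⟨max s₀ (max s₁ s₂), fun s hs i hi => ?_⟩
    simp only [ge_iff_le, max_le_iff] at hs
    rcases Nat.lt_succ_iff_lt_or_eq.1 hi with hi | rfl
    · exact h₀ s hs.1 i hi
    · exact ⟨evalSteps_mono hs.2.1 h₁, fun h => (hA i).2 ⟨s, h⟩, fun h => mono hs.2.2 (h₂ h)⟩

/-- At stage `s`, the set with index `e` is seen to agree with the c.e. set with index `e₀` on a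
proportion of at least `ratOfCode t + 1 / (k + 1)` of the numbers below `n`. -/
def SeenAgreement (e₀ : ℕ) (t : ℕ × ℕ × ℕ) (e k n s : ℕ) : Prop :=
  (∀ i < n, (evalSteps s e i).isSome) ∧
    (t.1 * (k + 1) + (t.2.2 + 1)) * n ≤
      Nat.count (fun i => (evalSteps s e₀ i).isSome ↔ evalSteps s e i = some 0) n *
        ((t.2.2 + 1) * (k + 1)) + t.2.1 * (k + 1) * n

theorem computablePred_seenAgreement (e₀ : ℕ) {α : Type*} [Primcodable α] {t : α → ℕ × ℕ × ℕ}
    {e k n s : α → ℕ} (ht : Computable t) (he : Computable e) (hk : Computable k)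
    (hn : Computable n) (hs : Computable s) :
    ComputablePred fun a => SeenAgreement e₀ (t a) (e a) (k a) (n a) (s a) := by
  have hx (e' : α → ℕ) (he' : Computable e') :
      Computable fun x : α × ℕ => evalSteps (s x.1) (e' x.1) x.2 :=
    computable_evalSteps (hs.comp Computable.fst) (he'.comp Computable.fst) Computable.snd
  have hsome (e' : α → ℕ) (he' : Computable e') :
      ComputablePred fun x : α × ℕ => (evalSteps (s x.1) (e' x.1) x.2).isSome :=
    computablePred_eq (Primrec.option_isSome.to_comp.comp (hx e' he')) (Computable.const true)
  have hzero : ComputablePred fun x : α × ℕ => evalSteps (s x.1) (e x.1) x.2 = some 0 :=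
    computablePred_eq (hx e he) (Computable.const _)
  have hiff : ComputablePred fun x : α × ℕ =>
      ((evalSteps (s x.1) e₀ x.2).isSome ↔ evalSteps (s x.1) (e x.1) x.2 = some 0) :=
    (computablePred_or (computablePred_and (hsome _ (Computable.const e₀)) hzero)
      (computablePred_and (hsome _ (Computable.const e₀)).not hzero.not)).of_eq
        fun x => iff_iff_and_or_not_and_not.symm
  have one : Computable fun _ : α => 1 := Computable.const 1
  have hk1 := computable_add hk one
  have ht1 : Computable fun a => (t a).1 := Computable.fst.comp ht
  have ht2 : Computable fun a => (t a).2.1 := Computable.fst.comp (Computable.snd.comp ht)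
  have ht3 := computable_add
    (show Computable fun a => (t a).2.2 from Computable.snd.comp (Computable.snd.comp ht)) one
  exact computablePred_and (computablePred_forall_lt (hsome e he) hn)
    (computablePred_le
      (computable_mul (computable_add (computable_mul ht1 hk1) ht3) hn)
      (computable_add (computable_mul (computable_count hiff hn) (computable_mul ht3 hk1))
        (computable_mul (computable_mul ht2 hk1) hn)))

/-- At a settled stage the observed count is the true one, and the test is the density inequality
with denominators cleared. -/
theorem seenAgreement_iff {e₀ e : ℕ} {A B : Set ℕ} {f : ℕ → ℕ} (hB : ∀ x, f x = 0 ↔ x ∈ B)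
    {n s : ℕ} (hn : 0 < n) (h : ∀ i < n, evalSteps s e i = some (f i) ∧
      ((evalSteps s e₀ i).isSome ↔ i ∈ A)) (t : ℕ × ℕ × ℕ) (k : ℕ) :
    SeenAgreement e₀ t e k n s ↔
      (ratOfCode t : ℝ) + 1 / (k + 1) ≤ densityBelow (agreement A B) n := by
  classical
  have hcount : Nat.count (fun i => (evalSteps s e₀ i).isSome ↔ evalSteps s e i = some 0) n =
      Nat.count (· ∈ agreement A B) n := by
    rw [Nat.count_eq_card_filter_range, Nat.count_eq_card_filter_range]
    congr 1
    refine Finset.filter_congr fun i hi => ?_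
    obtain ⟨h1, h2⟩ := h i (Finset.mem_range.1 hi)
    rw [h1, h2, Option.some_inj, hB]
    rfl
  have hall : ∀ i < n, (evalSteps s e i).isSome := fun i hi => by rw [(h i hi).1]; rfl
  have hn' : (0 : ℝ) < n := by exact_mod_cast hn
  have hk : (0 : ℝ) < (k : ℝ) + 1 := by positivity
  have hc : (0 : ℝ) < (t.2.2 : ℝ) + 1 := by positivity
  unfold SeenAgreement
  rw [hcount, and_iff_right hall, densityBelow_eq_count, ratOfCode, ← Nat.cast_le (α := ℝ)]
  push_cast
  rw [div_add_div _ _ hc.ne' hk.ne', div_le_div_iff₀ (by positivity) hn']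
  constructor <;> intro h' <;> nlinarith

theorem isLeftSigmaThree_gamma {A : Set ℕ} (hA : IsCE A) : IsLeftSigmaThree (gamma A) := by
  obtain ⟨e₀, he₀⟩ := exists_index_of_rePred hA
  -- Here x codes (e, k, N) and y codes (n, u). The clause u ≤ z is needed because observed
  -- agreement is not monotone in the stage: an element entering A later may destroy it.
  refine ⟨fun a => a.2.1.unpair.2.unpair.2 < a.2.2.1.unpair.1 →
    a.2.2.1.unpair.2 ≤ a.2.2.2 ∧ SeenAgreement e₀ a.1 a.2.1.unpair.1 a.2.1.unpair.2.unpair.1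
      a.2.2.1.unpair.1 a.2.2.2, ?_, fun t => ?_⟩
  · have hx : Computable fun a : (ℕ × ℕ × ℕ) × ℕ × ℕ × ℕ => a.2.1.unpair :=
      Computable.unpair.comp (Computable.fst.comp Computable.snd)
    have hx2 : Computable fun a : (ℕ × ℕ × ℕ) × ℕ × ℕ × ℕ => a.2.1.unpair.2.unpair :=
      Computable.unpair.comp (Computable.snd.comp hx)
    have hy : Computable fun a : (ℕ × ℕ × ℕ) × ℕ × ℕ × ℕ => a.2.2.1.unpair :=
      Computable.unpair.comp (Computable.fst.comp (Computable.snd.comp Computable.snd))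
    have hz : Computable fun a : (ℕ × ℕ × ℕ) × ℕ × ℕ × ℕ => a.2.2.2 :=
      Computable.snd.comp (Computable.snd.comp Computable.snd)
    have h1 := computablePred_lt (Computable.snd.comp hx2) (Computable.fst.comp hy)
    have h2 := computablePred_le (Computable.snd.comp hy) hz
    have h3 := computablePred_seenAgreement e₀ Computable.fst (Computable.fst.comp hx)
      (Computable.fst.comp hx2) (Computable.fst.comp hy) hz
    exact (computablePred_or h1.not (computablePred_and h2 h3)).of_eq fun a => imp_iff_not_or.symm
  · refine lt_gamma_iff.trans ⟨?_, ?_⟩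
    · rintro ⟨B, hB, hlt⟩
      obtain ⟨e, f, hf, hfB⟩ := exists_index_of_computablePred hB
      -- The margin 1/(k+1) makes the strict inequality survive the passage to the liminf in the
      -- converse.
      obtain ⟨k, hk⟩ := exists_nat_one_div_lt (sub_pos.2 hlt)
      obtain ⟨N, hN⟩ := eventually_atTop.1
        (eventually_lt_densityBelow (lt_sub_iff_add_lt'.1 hk))
      refine ⟨Nat.pair e (Nat.pair k N), fun y => ?_⟩
      obtain ⟨s₀, hs₀⟩ := exists_forall_evalSteps_eq he₀ hf y.unpair.1
      refine ⟨max s₀ y.unpair.2, fun hNy => ⟨le_max_right _ _, ?_⟩⟩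
      simp only [Nat.unpair_pair] at hNy ⊢
      exact (seenAgreement_iff hfB (Nat.zero_lt_of_lt hNy) (hs₀ _ (le_max_left _ _)) t k).2
        (hN _ hNy.le).le
    · rintro ⟨x, hx⟩
      set e := x.unpair.1
      set k := x.unpair.2.unpair.1
      set N := x.unpair.2.unpair.2
      have hx' (n u : ℕ) (hn : N < n) : ∃ s ≥ u, SeenAgreement e₀ t e k n s := by
        obtain ⟨s, hs⟩ := hx (Nat.pair n u)
        simp only [Nat.unpair_pair] at hs
        exact ⟨s, hs hn⟩
      have htot (i : ℕ) : ∃ v s, evalSteps s e i = some v := by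
        obtain ⟨s, -, hs⟩ := hx' (max N i + 1) 0 (by omega)
        obtain ⟨v, hv⟩ := Option.isSome_iff_exists.1 (hs.1 i (by omega))
        exact ⟨v, s, hv⟩
      choose f hf using htot
      refine ⟨{x | f x = 0}, computablePred_eq (computable_of_index hf) (Computable.const 0), ?_⟩
      refine (lt_add_of_pos_right _ (Nat.one_div_pos_of_nat (n := k))).trans_le
        (le_lowerDensity ((eventually_gt_atTop N).mono fun n hn => ?_))
      obtain ⟨s₀, hs₀⟩ := exists_forall_evalSteps_eq he₀ hf n
      -- Taking u to be the settling stage makes the observation a true one.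
      obtain ⟨s, hs, hseen⟩ := hx' n s₀ hn
      exact (seenAgreement_iff (fun _ => Iff.rfl) (Nat.zero_lt_of_lt hn) (hs₀ s hs) t k).1 hseen

/-! ### Every left-`Σ⁰₃` real in the unit interval is a coarse computability bound -/

/-- A left-`Σ⁰₃` real is the supremum of those members of a computable sequence of rationals that
satisfy a `Π⁰₂` condition. -/
theorem IsLeftSigmaThree.exists_sequence {r : ℝ} (hr : IsLeftSigmaThree r) :
    ∃ (c : ℕ → ℕ × ℕ × ℕ) (S : ℕ × ℕ × ℕ → Prop), Computable c ∧ ComputablePred S ∧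
      (∀ k, (∀ y, ∃ z, S (k, y, z)) → (ratOfCode (c k) : ℝ) < r) ∧
      ∀ t, (ratOfCode t : ℝ) < r → ∃ k, c k = t ∧ ∀ y, ∃ z, S (k, y, z) := by
  obtain ⟨R, hR, hiff⟩ := hr
  -- The number k pairs a code of a triple with a witness for the outer quantifier. The default is
  -- harmless, since the condition tests whatever triple `c k` is.
  let c : ℕ → ℕ × ℕ × ℕ := fun k => (Encodable.decode k.unpair.1).getD (0, 0, 0)
  have hc : Computable c :=
    Computable.option_getD (Computable.decode.comp (Computable.fst.comp Computable.unpair))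
      (Computable.const _)
  refine ⟨c, fun a => R (c a.1, a.1.unpair.2, a.2), hc, ?_, fun k hk => ?_, fun t ht => ?_⟩
  · exact computablePred_comp hR ((hc.comp Computable.fst).pair
      ((Computable.snd.comp (Computable.unpair.comp Computable.fst)).pair Computable.snd))
  · exact (hiff (c k)).2 ⟨k.unpair.2, hk⟩
  · obtain ⟨x, hx⟩ := (hiff t).1 ht
    have hct : c (Nat.pair (Encodable.encode t) x) = t := by
      simp only [c, Nat.unpair_pair, Encodable.encodek, Option.getD_some]
    exact ⟨Nat.pair (Encodable.encode t) x, hct, fun y => by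
      simpa [hct] using hx y⟩

theorem exists_ratOfCode_eq (q : ℚ) : ∃ t, ratOfCode t = q := by
  refine ⟨(q.num.toNat, (-q.num).toNat, q.den - 1), ?_⟩
  have h1 : ((q.num.toNat : ℤ) : ℚ) - (((-q.num).toNat : ℤ) : ℚ) = q.num := by
    rw [← Int.cast_sub]
    congr 1
    omega
  have h2 : ((q.den - 1 : ℕ) : ℚ) + 1 = q.den := by
    exact_mod_cast Nat.sub_add_cancel q.den_pos
  rw [ratOfCode, h2]
  push_cast at h1
  rw [h1, Rat.num_div_den]

/-- The number `n` such that `x` belongs to the interval `[n!, (n + 1)!)`. -/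
def level (x : ℕ) : ℕ :=
  Nat.findGreatest (fun n => n.factorial ≤ x) x

theorem lt_factorial_of_level_lt {x n : ℕ} (h : level x < n) : x < n.factorial := by
  by_contra! hx
  exact h.not_ge (Nat.le_findGreatest ((Nat.self_le_factorial n).trans hx) hx)

theorem level_eq {x n : ℕ} (h : n.factorial ≤ x) (h' : x < (n + 1).factorial) :
    level x = n := by
  refine le_antisymm ?_ (Nat.le_findGreatest ((Nat.self_le_factorial n).trans h) h)
  by_contra! hlt
  have : (level x).factorial ≤ x :=
    Nat.findGreatest_of_ne_zero (P := fun n => n.factorial ≤ x) (n := x) rfl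
      (Nat.ne_zero_of_lt hlt)
  exact (h'.trans_le (Nat.factorial_le hlt)).not_ge this

theorem primrec_factorial : Primrec Nat.factorial := by
  have h : Primrec₂ fun n m : ℕ => (n + 1) * m :=
    Primrec.nat_mul.comp (Primrec.succ.comp Primrec.fst) Primrec.snd
  exact (Primrec.nat_rec₁ 1 h).of_eq fun n => by
    induction n with
    | zero => rfl
    | succ n ih => simp [Nat.factorial_succ, ih]

theorem computable_level : Computable level :=
  (Primrec.nat_findGreatest (p := fun x n => n.factorial ≤ x) Primrec.id
    (Primrec.nat_le.comp (primrec_factorial.comp Primrec.snd) Primrec.fst)).to_comp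

/-- The index of the function against which membership of `x` is used to diagonalize. -/
def target (x : ℕ) : ℕ :=
  (level x).unpair.1

theorem computable_target : Computable target :=
  Computable.fst.comp (Computable.unpair.comp computable_level)

/-- The function with index `e` is defined up to `x`, and it vanishes at `x`. -/
def VanishesAt (e x : ℕ) : Prop :=
  ∃ s, (∀ y < x + 1, (evalSteps s e y).isSome) ∧ evalSteps s e x = some 0

/-- The first `n` instances of the `Π⁰₂` condition `∀ y, ∃ z, S (k, y, z)` hold. -/
def Confirmed (S : ℕ × ℕ × ℕ → Prop) (k n : ℕ) : Prop :=
  ∃ s, ∀ y < n, ∃ z < s, S (k, y, z)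

theorem confirmed_of_forall {S : ℕ × ℕ × ℕ → Prop} {k : ℕ} (h : ∀ y, ∃ z, S (k, y, z)) (n : ℕ) :
    Confirmed S k n := by
  choose g hg using h
  refine ⟨(Finset.range n).sup g + 1, fun y hy => ⟨g y, ?_, hg y⟩⟩
  exact Nat.lt_succ_of_le (Finset.le_sup (Finset.mem_range.2 hy))

theorem exists_forall_confirmed_le {S : ℕ × ℕ × ℕ → Prop} {k : ℕ}
    (h : ¬ ∀ y, ∃ z, S (k, y, z)) : ∃ N, ∀ n, Confirmed S k n → n ≤ N := by
  push Not at h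
  obtain ⟨N, hN⟩ := h
  refine ⟨N, fun n ⟨s, hs⟩ => ?_⟩
  by_contra! hlt
  obtain ⟨z, -, hz⟩ := hs N hlt
  exact hN z hz

/-- The c.e. set whose coarse computability bound is the supremum of all `ratOfCode (c k)` with
`∀ y, ∃ z, S (k, y, z)`. -/
def diagonalSet (c : ℕ → ℕ × ℕ × ℕ) (S : ℕ × ℕ × ℕ → Prop) : Set ℕ :=
  {x | VanishesAt (target x) x ∨
    ∃ k < target x + 1, x ∈ initialParts (ratOfCode (c k)) ∧ Confirmed S k (level x)}

variable {c : ℕ → ℕ × ℕ × ℕ} {S : ℕ × ℕ × ℕ → Prop}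

theorem isCE_diagonalSet (hc : Computable c) (hS : ComputablePred S) :
    IsCE (diagonalSet c S) := by
  have heval : Computable fun a : (ℕ × ℕ) × ℕ => evalSteps a.1.2 (target a.1.1) a.2 :=
    computable_evalSteps (Computable.snd.comp Computable.fst)
      (computable_target.comp (Computable.fst.comp Computable.fst)) Computable.snd
  have hdef : ComputablePred fun a : ℕ × ℕ =>
      ∀ y < a.1 + 1, (evalSteps a.2 (target a.1) y).isSome :=
    computablePred_forall_lt (p := fun a y => (evalSteps a.2 (target a.1) y).isSome)
      (computablePred_eq (Primrec.option_isSome.to_comp.comp heval) (Computable.const true))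
      (computable_add Computable.fst (Computable.const 1))
  have hzero : ComputablePred fun a : ℕ × ℕ => evalSteps a.2 (target a.1) a.1 = some 0 :=
    computablePred_eq (computable_evalSteps Computable.snd
      (computable_target.comp Computable.fst) Computable.fst) (Computable.const _)
  have hinit : ComputablePred fun a : (ℕ × ℕ) × ℕ =>
      a.1.1 ∈ initialParts (ratOfCode (c a.2)) :=
    computablePred_comp (f := fun a : (ℕ × ℕ) × ℕ => (c a.2, a.1.1)) computablePred_mem_initialParts
      ((hc.comp Computable.snd).pair (Computable.fst.comp Computable.fst))
  have hS' : ComputablePred fun a : (((ℕ × ℕ) × ℕ) × ℕ) × ℕ => S (a.1.1.2, a.1.2, a.2) :=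
    computablePred_comp hS
      ((Computable.snd.comp (Computable.fst.comp Computable.fst)).pair
        ((Computable.snd.comp Computable.fst).pair Computable.snd))
  have hconf : ComputablePred fun a : (ℕ × ℕ) × ℕ =>
      ∀ y < level a.1.1, ∃ z < a.1.2, S (a.2, y, z) :=
    computablePred_forall_lt (p := fun a y => ∃ z < a.1.2, S (a.2, y, z))
      (computablePred_exists_lt (p := fun a z => S (a.1.2, a.2, z)) hS'
        (Computable.snd.comp (Computable.fst.comp Computable.fst)))
      (computable_level.comp (Computable.fst.comp Computable.fst))
  have hguess : ComputablePred fun a : ℕ × ℕ => ∃ k < target a.1 + 1,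
      a.1 ∈ initialParts (ratOfCode (c k)) ∧ ∀ y < level a.1, ∃ z < a.2, S (k, y, z) :=
    computablePred_exists_lt (p := fun a k => a.1 ∈ initialParts (ratOfCode (c k)) ∧
        ∀ y < level a.1, ∃ z < a.2, S (k, y, z)) (computablePred_and hinit hconf)
      (computable_add (computable_target.comp Computable.fst) (Computable.const 1))
  refine (rePred_exists (computablePred_or (computablePred_and hdef hzero) hguess)).of_eq
    fun x => ?_
  simp only [diagonalSet, Set.mem_ofPred_eq, exists_or, VanishesAt, Confirmed]
  refine or_congr Iff.rfl ⟨?_, ?_⟩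
  · rintro ⟨s, k, hk, hx, hs⟩
    exact ⟨k, hk, hx, s, hs⟩
  · rintro ⟨k, hk, hx, s, hs⟩
    exact ⟨s, k, hk, hx, hs⟩

theorem vanishesAt_iff {e : ℕ} {f : ℕ → ℕ} (hf : ∀ x, ∃ s, evalSteps s e x = some (f x)) (x : ℕ) :
    VanishesAt e x ↔ f x = 0 := by
  constructor
  · rintro ⟨s, -, hs⟩
    obtain ⟨t, ht⟩ := hf x
    exact evalSteps_unique ht hs
  · intro hx
    obtain ⟨s₀, hs₀⟩ := exists_forall_evalSteps_eq (e₀ := e)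
      (A := {x | ∃ s, (evalSteps s e x).isSome}) (fun _ => Iff.rfl) hf (x + 1)
    refine ⟨s₀, fun y hy => ?_, ?_⟩
    · rw [(hs₀ s₀ le_rfl y hy).1]; rfl
    · rw [(hs₀ s₀ le_rfl x x.lt_succ_self).1, hx]

/-- Requiring convergence at every argument up to x pays off here: if the function is partial, its
first components of failure bound the set, which is then finite; if it is total, its zero set is
computable. -/
theorem computablePred_vanishesAt (e : ℕ) : ComputablePred (VanishesAt e) := by
  by_cases h : ∀ x, ∃ v s, evalSteps s e x = some v
  · choose f hf using h
    exact (computablePred_eq (computable_of_index hf) (Computable.const 0)).of_eq fun x =>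
      (vanishesAt_iff hf x).symm
  · push Not at h
    obtain ⟨N, hN⟩ := h
    refine computablePred_of_bounded N fun x ⟨s, hs, _⟩ => ?_
    by_contra! hlt
    obtain ⟨v, hv⟩ := Option.isSome_iff_exists.1 (hs N (Nat.lt_succ_of_le hlt))
    exact hN v s hv

/-- Either condition k is true and confirmation imposes nothing, or it is false and only finitely
many levels, hence finitely many x, are confirmed. -/
theorem computablePred_mem_initialParts_and_confirmed (k : ℕ) :
    ComputablePred fun x => x ∈ initialParts (ratOfCode (c k)) ∧ Confirmed S k (level x) := by
  by_cases h : ∀ y, ∃ z, S (k, y, z)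
  · exact (computablePred_mem_initialParts_const (c k)).of_eq fun x =>
        (and_iff_left (confirmed_of_forall h _)).symm
  · obtain ⟨N, hN⟩ := exists_forall_confirmed_le h
    exact computablePred_of_bounded _ fun x hx =>
      lt_factorial_of_level_lt (Nat.lt_succ_of_le (hN _ hx.2))

theorem computablePred_target_lt_and_mem (k : ℕ) :
    ComputablePred fun x => target x < k ∧ x ∈ diagonalSet c S := by
  have h (e : ℕ) : ComputablePred fun x => target x = e ∧ (VanishesAt e x ∨
      ∃ k < e + 1, x ∈ initialParts (ratOfCode (c k)) ∧ Confirmed S k (level x)) :=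
    computablePred_and (computablePred_eq computable_target (Computable.const e))
      (computablePred_or (computablePred_vanishesAt e)
        (computablePred_exists_lt_const _ fun k _ =>
          computablePred_mem_initialParts_and_confirmed k))
  refine (computablePred_exists_lt_const k fun e _ => h e).of_eq fun x => ⟨?_, ?_⟩
  · rintro ⟨e, he, rfl, hx⟩
    exact ⟨he, hx⟩
  · rintro ⟨hk, hx⟩
    exact ⟨_, hk, rfl, hx⟩

theorem ratOfCode_le_gamma_diagonalSet {k : ℕ} (hk : ∀ y, ∃ z, S (k, y, z))
    (h0 : 0 ≤ (ratOfCode (c k) : ℝ)) (h1 : (ratOfCode (c k) : ℝ) ≤ 1) :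
    (ratOfCode (c k) : ℝ) ≤ gamma (diagonalSet c S) := by
  -- Small targets must be copied exactly: they occupy infinitely many intervals, on which guess k
  -- is never used.
  let B : Set ℕ := {x | (target x < k ∧ x ∈ diagonalSet c S) ∨
    (k ≤ target x ∧ x ∈ initialParts (ratOfCode (c k)))}
  have hB : ComputablePred (· ∈ B) :=
    computablePred_or (computablePred_target_lt_and_mem k)
      (computablePred_and (computablePred_le (Computable.const k) computable_target)
        (computablePred_mem_initialParts_const (c k)))
  have hsub : initialParts (ratOfCode (c k)) ⊆ agreement (diagonalSet c S) B := by
    intro x hx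
    rcases lt_or_ge (target x) k with hlt | hle
    · simp [agreement, B, hlt, hlt.not_ge]
    · have : x ∈ diagonalSet c S :=
        Or.inr ⟨k, Nat.lt_succ_of_le hle, hx, confirmed_of_forall hk _⟩
      simp [agreement, B, this, hle, hx]
  calc (ratOfCode (c k) : ℝ) = lowerDensity (initialParts (ratOfCode (c k))) :=
        (lowerDensity_initialParts h0 h1).symm
    _ ≤ lowerDensity (agreement (diagonalSet c S) B) := lowerDensity_mono hsub
    _ ≤ gamma (diagonalSet c S) := le_gamma hB

/-- Long enough intervals diagonalizing against the computable set `B` carry agreement with `B`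
only on the initial parts of length `r`. -/
theorem exists_forall_mem_initialParts {r : ℝ}
    (hr : ∀ k, (∀ y, ∃ z, S (k, y, z)) → (ratOfCode (c k) : ℝ) < r)
    {B : Set ℕ} (hB : ComputablePred (· ∈ B)) :
    ∃ e N, ∀ x, target x = e → N < level x → x ∈ agreement (diagonalSet c S) B →
      x ∈ initialParts r := by
  -- The index is that of the complement, so copying zeros of f produces disagreement with B.
  obtain ⟨e, f, hf, hfB⟩ := exists_index_of_computablePred hB.not
  have hN (k : ℕ) : ∃ N, ¬ (∀ y, ∃ z, S (k, y, z)) → ∀ n, Confirmed S k n → n ≤ N := by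
    by_cases h : ∀ y, ∃ z, S (k, y, z)
    · exact ⟨0, fun h' => absurd h h'⟩
    · obtain ⟨N, hN⟩ := exists_forall_confirmed_le h
      exact ⟨N, fun _ => hN⟩
  choose N hN using hN
  -- Only guesses k ≤ e act on target e, so a single bound outlasts all false ones.
  refine ⟨e, (Finset.range (e + 1)).sup N, fun x hx hlevel hagree => ?_⟩
  by_contra hnot
  have hiff : x ∈ diagonalSet c S ↔ f x = 0 := by
    rw [← vanishesAt_iff hf, diagonalSet, Set.mem_ofPred_eq, hx]
    refine or_iff_left ?_
    rintro ⟨k, hk, hxk, hconf⟩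
    by_cases h : ∀ y, ∃ z, S (k, y, z)
    · exact hnot (initialParts_mono (hr k h).le hxk)
    · exact hlevel.not_ge ((hN k h _ hconf).trans (Finset.le_sup (Finset.mem_range.2 hk)))
  have h1 : x ∈ diagonalSet c S ↔ x ∈ B := hagree
  have h2 := hfB x
  tauto

/-- The numbers below n! make up only the fraction 1/(n+1) of those below (n+1)!. -/
theorem densityBelow_factorial_le {A D : Set ℕ} {n : ℕ}
    (h : ∀ x ∈ A, n.factorial ≤ x → x < (n + 1).factorial → x ∈ D) :
    densityBelow A (n + 1).factorial ≤ 1 / (n + 1) + densityBelow D (n + 1).factorial := by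
  have hsub : A ∩ Set.Iio (n + 1).factorial ⊆
      Set.Iio n.factorial ∪ D ∩ Set.Iio (n + 1).factorial := by
    rintro x ⟨hx, hlt⟩
    rcases lt_or_ge x n.factorial with hx' | hx'
    · exact Or.inl hx'
    · exact Or.inr ⟨h x hx hx' hlt, hlt⟩
  have hcard : (A ∩ Set.Iio (n + 1).factorial).ncard ≤
      n.factorial + (D ∩ Set.Iio (n + 1).factorial).ncard := by
    refine (Set.ncard_le_ncard hsub ((Set.finite_Iio _).union
      ((Set.finite_Iio _).inter_of_right _))).trans ((Set.ncard_union_le _ _).trans ?_)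
    simp [Set.ncard_eq_toFinset_card']
  have hpos : (0 : ℝ) < n.factorial := by exact_mod_cast n.factorial_pos
  have h1 : (1 : ℝ) / (n + 1) = n.factorial / (n + 1).factorial := by
    rw [Nat.factorial_succ]
    push_cast
    field_simp
  rw [h1, densityBelow, densityBelow, ← add_div]
  gcongr
  exact_mod_cast hcard

theorem gamma_diagonalSet_le {r : ℝ} (h0 : 0 ≤ r) (h1 : r ≤ 1)
    (hr : ∀ k, (∀ y, ∃ z, S (k, y, z)) → (ratOfCode (c k) : ℝ) < r) :
    gamma (diagonalSet c S) ≤ r := by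
  by_contra! hlt
  obtain ⟨B, hB, hrB⟩ := lt_gamma_iff.1 hlt
  refine hrB.not_ge (le_of_forall_pos_le_add fun ε hε => ?_)
  obtain ⟨e, N, hN⟩ := exists_forall_mem_initialParts hr hB
  have hfac : Tendsto (fun n : ℕ => (n + 1).factorial) atTop atTop :=
    tendsto_atTop_mono (fun n => (Nat.le_succ n).trans (Nat.self_le_factorial _)) tendsto_id
  have hlim : Tendsto (fun n : ℕ => 1 / ((n : ℝ) + 1) +
      densityBelow (initialParts r) (n + 1).factorial) atTop (𝓝 (0 + r)) :=
    tendsto_one_div_add_atTop_nhds_zero_nat.add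
      ((tendsto_densityBelow_initialParts h0 h1).comp hfac)
  obtain ⟨n₀, hn₀⟩ := eventually_atTop.1
    (((hlim.eventually_le_const (show 0 + r < r + ε by linarith)).and
      (eventually_gt_atTop N)))
  refine lowerDensity_le (frequently_atTop.2 fun a => ?_)
  -- Pairing e with large numbers gives arbitrarily late intervals with target e; the liminf needs
  -- only these.
  obtain ⟨n, hn, hne⟩ : ∃ n, max n₀ a ≤ n ∧ n.unpair.1 = e :=
    ⟨Nat.pair e (max n₀ a), Nat.right_le_pair _ _, by simp⟩
  obtain ⟨hbound, hNn⟩ := hn₀ n ((le_max_left _ _).trans hn)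
  refine ⟨(n + 1).factorial, ?_, (densityBelow_factorial_le fun x hx hle hlt => ?_).trans hbound⟩
  · exact ((le_max_right _ _).trans hn).trans ((Nat.le_succ n).trans (Nat.self_le_factorial _))
  · have hlevel : level x = n := level_eq hle hlt
    exact hN x (by rw [target, hlevel, hne]) (by rwa [hlevel]) hx

theorem IsLeftSigmaThree.exists_isCE_gamma_eq {r : ℝ} (h0 : 0 ≤ r) (h1 : r ≤ 1)
    (hr : IsLeftSigmaThree r) : ∃ A : Set ℕ, IsCE A ∧ r = gamma A := by
  obtain ⟨c, S, hc, hS, hlt, hex⟩ := hr.exists_sequence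
  refine ⟨diagonalSet c S, isCE_diagonalSet hc hS,
    le_antisymm ?_ (gamma_diagonalSet_le h0 h1 hlt)⟩
  by_contra! hγ
  obtain ⟨q, hq, hqr⟩ := exists_rat_btwn hγ
  obtain ⟨t, rfl⟩ := exists_ratOfCode_eq q
  obtain ⟨k, rfl, hk⟩ := hex t hqr
  -- This places the chosen rational in [0, 1], where initial parts have the prescribed density.
  have hγ0 : 0 ≤ gamma (diagonalSet c S) := Real.sSup_nonneg fun _ hx => hx.1.1
  exact hq.not_ge
    (ratOfCode_le_gamma_diagonalSet hk (hγ0.trans hq.le) (hqr.le.trans h1))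

end CoarseComputability

theorem theorem6p2 (r : ℝ) (h0 : 0 ≤ r) (h1 : r ≤ 1) :
    (∃ A : Set ℕ, CoarseComputability.IsCE A ∧ r = CoarseComputability.gamma A) ↔
      CoarseComputability.IsLeftSigmaThree r := by
  refine ⟨?_, CoarseComputability.IsLeftSigmaThree.exists_isCE_gamma_eq h0 h1⟩
  rintro ⟨A, hA, rfl⟩
  exact CoarseComputability.isLeftSigmaThree_gamma hA
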